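/- Let $d\ge 1$ and $l>0$. De Sitter spacetime $(M,g)$ of dimension $d+1$ and radius of curvature $l$ is the hyperboloid $M=\{x\in\mathbb{R}^{1+(d+1)} : -x_0^2+\sum_{i=1}^{d+1}x_i^2=l^2\}$ with the metric $g$ induced by the Minkowski metric $dx_0^2-\sum_{i=1}^{d+1} dx_i^2$, time-oriented by $x_0$. Let $\tilde M=[-\pi/2,\pi/2]\times S^d$ with the metric $\tilde g=d\eta^2-d\omega^2$, where $d\omega^2$ is the round metric of the unit sphere $S^d\subset\mathbb{R}^{d+1}$, time-oriented by $\eta$, and let $\mathcal I^{-}=\{-\pi/2\}\times S^d$ and $\mathcal I^{+}=\{\pi/2\}\times S^d$. A smooth timelike curve in $\tilde M$ is a smooth curve $\gamma:[0,1]\to\tilde M$ with $\tilde g(\gamma',\gamma')>0$ on all of $[0,1]$. Then the following hold. (1) $(\tilde M,\tilde g)$ is a conformal compactification of $(M,g)$: $\tilde M$ is compact, and with $\psi(\eta,n)=(l\tan\eta,\,(l/\cos\eta)\,n)$ and $\Omega(\eta,n)=\cos\eta/l$, the map $\psi$ is a diffeomorphism from the interior of $\tilde M$ onto $M$ that respects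 the time orientations, $\tilde g=\Omega^2\psi^*g$ in the interior, and $\Omega$ is smooth, positive in the interior, and satisfies $\Omega=0$ and $d\Omega\ne0$ on the boundary $\mathcal I^-\cup\mathcal I^+$. (2) De Sitter spacetime does not have the Penrose property: it is not the case that every $p\in\mathcal I^-$ and every $q\in\mathcal I^+$ are connected by a smooth timelike curve in $\tilde M$ from $p$ to $q$. (3) For every $p=(-\pi/2,n)\in\mathcal I^-$, the antipodal point $(\pi/2,-n)$ is the only point of $\mathcal I^+$ that cannot be reached from $p$ by a smooth timelike curve in $\tilde M$; that is, $\{q\in\mathcal I^+ : \text{no smooth timelike curve in } \tilde M \text{ goes from } p \text{ to } q\}=\{(\pi/2,-n)\}$. -/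

import Mathlib

open scoped ContDiff

namespace DeSitter

/-- The vector space `ℝ × ℝ^{d+1}`, a time coordinate followed by `d + 1` space coordinates.
It is the ambient space of both de Sitter spacetime and its conformal compactification. -/
abbrev Ambient (d : ℕ) : Type := ℝ × EuclideanSpace ℝ (Fin (d + 1))

/-- The flat Lorentzian form `v₀ w₀ - ∑ vᵢ wᵢ` of signature `(+,-,…,-)` on `ℝ × ℝ^{d+1}`. -/
noncomputable def lorentz {d : ℕ} (v w : Ambient d) : ℝ := v.1 * w.1 - inner ℝ v.2 w.2

/-! ### The physical spacetime `(M, g)` -/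

/-- De Sitter spacetime `M` of dimension `d + 1` and radius of curvature `l`: the hyperboloid
`-x₀² + ∑ xᵢ² = l²` in Minkowski space of dimension `d + 2`.  Its metric `g` is the restriction
of `lorentz` to its tangent spaces, and `x₀` increases towards the future. -/
def spacetime (d : ℕ) (l : ℝ) : Set (Ambient d) :=
  {x | -x.1 ^ 2 + ∑ i, x.2 i ^ 2 = l ^ 2}

/-- The tangent space of the hyperboloid at its point `x`. -/
def tangent {d : ℕ} (x : Ambient d) : Set (Ambient d) := {v | lorentz x v = 0}

/-! ### The conformal compactification `(M̃, g̃)` -/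

/-- The compactified spacetime `M̃ = [-π/2, π/2] × S^d`, a manifold with boundary.  Its metric
`g̃ = dη² - dω²`, with `dω²` the round metric of `S^d`, is the restriction of `lorentz` to its
tangent spaces, and `η` increases towards the future. -/
def compactified (d : ℕ) : Set (Ambient d) :=
  {y | -(Real.pi / 2) ≤ y.1 ∧ y.1 ≤ Real.pi / 2 ∧ ‖y.2‖ = 1}

/-- The tangent space of `[-π/2, π/2] × S^d` at its point `y`. -/
def compactifiedTangent {d : ℕ} (y : Ambient d) : Set (Ambient d) := {v | inner ℝ y.2 v.2 = 0}

/-- Past null infinity `𝓘⁻ = {-π/2} × S^d`. -/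
def scriMinus (d : ℕ) : Set (Ambient d) := {y | y.1 = -(Real.pi / 2) ∧ ‖y.2‖ = 1}

/-- Future null infinity `𝓘⁺ = {π/2} × S^d`. -/
def scriPlus (d : ℕ) : Set (Ambient d) := {y | y.1 = Real.pi / 2 ∧ ‖y.2‖ = 1}

/-- The interior of `M̃`. -/
def interiorPart (d : ℕ) : Set (Ambient d) := compactified d \ (scriMinus d ∪ scriPlus d)

/-- The map `(η, n) ↦ (l tan η, (l / cos η) n)`, which identifies the interior of `M̃`
with de Sitter spacetime. -/
noncomputable def conformalMap {d : ℕ} (l : ℝ) (y : Ambient d) : Ambient d :=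
  (l * Real.tan y.1, (l / Real.cos y.1) • y.2)

/-- The conformal factor `Ω = cos η / l`. -/
noncomputable def conformalFactor {d : ℕ} (l : ℝ) (y : Ambient d) : ℝ := Real.cos y.1 / l

/-- `(M̃, g̃)`, with the identification `ψ` of its interior with `M` and the conformal factor `Ω`,
is a conformal compactification of de Sitter spacetime `(M, g)`: the space `M̃` is compact, `ψ` is
a diffeomorphism from the interior of `M̃` onto `M` which respects the time orientations, one has
`g̃ = Ω² ψ^* g`, and `Ω` is a smooth function which is positive in the interior and which has
`Ω = 0`, `dΩ ≠ 0` on the boundary `𝓘⁻ ∪ 𝓘⁺`. -/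
structure IsConformalCompactification (d : ℕ) (l : ℝ) (ψ : Ambient d → Ambient d)
    (Ω : Ambient d → ℝ) : Prop where
  isCompact : IsCompact (compactified d)
  bijOn : Set.BijOn ψ (interiorPart d) (spacetime d l)
  smooth : ∀ y ∈ interiorPart d, ContDiffAt ℝ ∞ ψ y
  smooth_inverse : ∃ χ : Ambient d → Ambient d,
    Set.LeftInvOn χ ψ (interiorPart d) ∧ ∀ x ∈ spacetime d l, ContDiffAt ℝ ∞ χ x
  tangent_map : ∀ y ∈ interiorPart d, ∀ v ∈ compactifiedTangent y, fderiv ℝ ψ y v ∈ tangent (ψ y)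
  conformal : ∀ y ∈ interiorPart d, ∀ v ∈ compactifiedTangent y, ∀ w ∈ compactifiedTangent y,
    lorentz v w = Ω y ^ 2 * lorentz (fderiv ℝ ψ y v) (fderiv ℝ ψ y w)
  time_orientation : ∀ y ∈ interiorPart d, ∀ v ∈ compactifiedTangent y,
    0 < lorentz v v → 0 < v.1 → 0 < (fderiv ℝ ψ y v).1
  factor_smooth : ContDiff ℝ ∞ Ω
  factor_pos : ∀ y ∈ interiorPart d, 0 < Ω y
  factor_zero : ∀ y ∈ scriMinus d ∪ scriPlus d, Ω y = 0
  factor_deriv : ∀ y ∈ scriMinus d ∪ scriPlus d, ∃ v ∈ compactifiedTangent y, fderiv ℝ Ω y v ≠ 0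

/-! ### Timelike curves and the Penrose property -/

/-- A smooth timelike curve `γ : [0, 1] → M̃`: its velocity `γ'` has `g̃(γ', γ') > 0` everywhere,
endpoints included. -/
structure IsTimelikeCurve {d : ℕ} (γ : ℝ → Ambient d) : Prop where
  smooth : ContDiffOn ℝ ∞ γ (Set.Icc 0 1)
  mem : ∀ t ∈ Set.Icc (0 : ℝ) 1, γ t ∈ compactified d
  timelike : ∀ t ∈ Set.Icc (0 : ℝ) 1,
    0 < lorentz (derivWithin γ (Set.Icc 0 1) t) (derivWithin γ (Set.Icc 0 1) t)

/-- There is a smooth timelike curve in `M̃` from `p` to `q`. -/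
def TimelikeConnected {d : ℕ} (p q : Ambient d) : Prop :=
  ∃ γ : ℝ → Ambient d, IsTimelikeCurve γ ∧ γ 0 = p ∧ γ 1 = q

/-- The Penrose property of de Sitter spacetime of dimension `d + 1`: every point of `𝓘⁻` can be
connected to every point of `𝓘⁺` by a smooth timelike curve in `M̃`. -/
def PenroseProperty (d : ℕ) : Prop :=
  ∀ p ∈ scriMinus d, ∀ q ∈ scriPlus d, TimelikeConnected p q

/-- The antipodal map `(η, n) ↦ (-η, -n)` of `M̃`, the extension of the map `x ↦ -x` of the
hyperboloid.  It takes the point `(-π/2, n)` of `𝓘⁻` to the point `(π/2, -n)` of `𝓘⁺`. -/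
def antipode {d : ℕ} (y : Ambient d) : Ambient d := (-y.1, -y.2)

end DeSitter

/-!
The compactification is a computation: the inverse of `ψ(η, n) = (l tan η, (l / cos η) n)` is the
restriction of the map `x ↦ (arctan (x₀ / l), (cos (arctan (x₀ / l)) / l) x⃗)`, smooth on the whole
ambient space, and the derivative of `ψ` is explicit (`DeSitter.fderiv_conformalMap`).

The causal statements rest on the fact that in `[-π/2, π/2] × S^d` a timelike curve covers less
angle on the sphere than it uses conformal time, while the total conformal time available is `π`,
exactly the distance of antipodal points of the sphere. For the antipodal point
(`DeSitter.not_timelikeConnected_antipode`), follow the angle `arccos ⟪n, ω⟫` between the starting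
direction `n` and the current direction `ω` from the last moment at which it vanishes to the first
later moment at which it equals `π`. In between it is differentiable with derivative
less than `η'`, so `η` would have to increase by more than `π`. Any other point `m` of
the sphere has angle `α < π` from `n`, and running along the great circle arc from `n` to `m` with
speed `α` while `η` grows with speed `π` is a timelike curve
(`DeSitter.timelikeConnected_of_ne_antipode`).
-/

namespace DeSitter

open Real Set
open scoped RealInnerProductSpace

variable {d : ℕ} {l : ℝ}

/-! ### The conformal compactification -/

lemma mem_interiorPart {y : Ambient d} :
    y ∈ interiorPart d ↔ y.1 ∈ Ioo (-(π / 2)) (π / 2) ∧ ‖y.2‖ = 1 := by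
  simp only [interiorPart, compactified, scriMinus, scriPlus, mem_sdiff, mem_union, mem_ofPred_eq,
    mem_Ioo]
  constructor
  · rintro ⟨⟨h1, h2, h3⟩, h⟩
    refine ⟨⟨lt_of_le_of_ne h1 fun e => h (Or.inl ⟨e.symm, h3⟩),
      lt_of_le_of_ne h2 fun e => h (Or.inr ⟨e, h3⟩)⟩, h3⟩
  · rintro ⟨⟨h1, h2⟩, h3⟩
    refine ⟨⟨h1.le, h2.le, h3⟩, ?_⟩
    rintro (h | h)
    · exact h1.ne' h.1
    · exact h2.ne h.1

lemma cos_pos_of_mem_interiorPart {y : Ambient d} (hy : y ∈ interiorPart d) : 0 < cos y.1 :=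
  cos_pos_of_mem_Ioo (mem_interiorPart.1 hy).1

lemma mem_spacetime {x : Ambient d} : x ∈ spacetime d l ↔ -x.1 ^ 2 + ‖x.2‖ ^ 2 = l ^ 2 := by
  simp [spacetime, EuclideanSpace.norm_sq_eq]

lemma isCompact_compactified (d : ℕ) : IsCompact (compactified d) := by
  have h : compactified d = Icc (-(π / 2)) (π / 2) ×ˢ Metric.sphere 0 1 := by
    ext y
    simp [compactified, and_assoc]
  rw [h]
  exact isCompact_Icc.prod (isCompact_sphere _ _)

/-- The inverse of the conformal map, given by a formula that is smooth on the whole ambient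
space. -/
noncomputable def conformalInverse (l : ℝ) (x : Ambient d) : Ambient d :=
  (arctan (x.1 / l), (cos (arctan (x.1 / l)) / l) • x.2)

lemma contDiff_conformalInverse : ContDiff ℝ ∞ (conformalInverse (d := d) l) := by
  have h : ContDiff ℝ ∞ fun x : Ambient d => arctan (x.1 / l) :=
    contDiff_arctan.comp (contDiff_fst.div_const l)
  exact h.prodMk (((contDiff_cos.comp h).div_const l).smul contDiff_snd)

lemma leftInvOn_conformalInverse (hl : 0 < l) :
    LeftInvOn (conformalInverse l) (conformalMap l) (interiorPart d) := by
  intro y hy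
  have hc := cos_pos_of_mem_interiorPart hy
  have h := (mem_interiorPart.1 hy).1
  simp only [conformalInverse, conformalMap, mul_div_cancel_left₀ _ hl.ne', arctan_tan h.1 h.2,
    smul_smul]
  have : cos y.1 / l * (l / cos y.1) = 1 := by field_simp
  rw [this, one_smul]

lemma rightInverse_conformalInverse (hl : 0 < l) :
    Function.RightInverse (conformalInverse (d := d) l) (conformalMap l) := by
  intro x
  have hc := cos_arctan_pos (x.1 / l)
  simp only [conformalInverse, conformalMap, tan_arctan, smul_smul]
  have : l / cos (arctan (x.1 / l)) * (cos (arctan (x.1 / l)) / l) = 1 := by field_simp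
  rw [this, one_smul, mul_div_cancel₀ _ hl.ne']

lemma mapsTo_conformalMap : MapsTo (conformalMap l) (interiorPart d) (spacetime d l) := by
  intro y hy
  have hc := cos_pos_of_mem_interiorPart hy
  rw [mem_spacetime]
  simp only [conformalMap, norm_smul, (mem_interiorPart.1 hy).2, mul_one, norm_eq_abs, sq_abs,
    tan_eq_sin_div_cos]
  field_simp
  linear_combination (-l ^ 2) * sin_sq_add_cos_sq y.1

lemma mapsTo_conformalInverse (hl : 0 < l) :
    MapsTo (conformalInverse l) (spacetime d l) (interiorPart d) := by
  intro x hx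
  rw [mem_spacetime] at hx
  rw [mem_interiorPart]
  refine ⟨arctan_mem_Ioo _, ?_⟩
  rw [← sq_eq_sq₀ (norm_nonneg _) zero_le_one]
  have h : ‖x.2‖ ^ 2 = l ^ 2 + x.1 ^ 2 := by linear_combination hx
  simp only [conformalInverse, norm_smul, mul_pow, norm_eq_abs, sq_abs, div_pow, cos_sq_arctan, h]
  field_simp

lemma bijOn_conformalMap (hl : 0 < l) :
    BijOn (conformalMap l) (interiorPart d) (spacetime d l) :=
  InvOn.bijOn ⟨leftInvOn_conformalInverse hl, (rightInverse_conformalInverse hl).rightInvOn _⟩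
    mapsTo_conformalMap (mapsTo_conformalInverse hl)

lemma contDiffAt_conformalMap {y : Ambient d} (hy : cos y.1 ≠ 0) :
    ContDiffAt ℝ ∞ (conformalMap l) y := by
  have ht : ContDiffAt ℝ ∞ (fun z : Ambient d => tan z.1) y :=
    (contDiffAt_tan.2 hy).comp y contDiffAt_fst
  have hc : ContDiffAt ℝ ∞ (fun z : Ambient d => cos z.1) y :=
    contDiff_cos.contDiffAt.comp y contDiffAt_fst
  exact (contDiffAt_const.mul ht).prodMk ((contDiffAt_const.div hc hy).smul contDiffAt_snd)

lemma fderiv_conformalMap {y : Ambient d} (hy : cos y.1 ≠ 0) (v : Ambient d) :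
    fderiv ℝ (conformalMap l) y v =
      (l / cos y.1 ^ 2 * v.1,
        (l / cos y.1) • v.2 + (l * sin y.1 / cos y.1 ^ 2 * v.1) • y.2) := by
  have h1 : HasFDerivAt (fun z : Ambient d => z.1) (ContinuousLinearMap.fst ℝ _ _) y :=
    hasFDerivAt_fst
  have ht := ((hasDerivAt_tan hy).const_mul l).comp_hasFDerivAt y h1
  have hc : HasDerivAt (fun s => l / cos s) (l * sin y.1 / cos y.1 ^ 2) y.1 :=
    ((hasDerivAt_const y.1 l).div (hasDerivAt_cos y.1) hy).congr_deriv (by ring)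
  have hs := (hc.comp_hasFDerivAt y h1).smul (hasFDerivAt_snd (𝕜 := ℝ) (p := y))
  have h : HasFDerivAt (conformalMap l) _ y := ht.prodMk hs
  rw [h.fderiv]
  ext <;> simp [div_eq_mul_inv]

theorem isConformalCompactification (d : ℕ) {l : ℝ} (hl : 0 < l) :
    IsConformalCompactification d l (conformalMap l) (conformalFactor l) where
  isCompact := isCompact_compactified d
  bijOn := bijOn_conformalMap hl
  smooth _ hy := contDiffAt_conformalMap (cos_pos_of_mem_interiorPart hy).ne'
  smooth_inverse := ⟨conformalInverse l, leftInvOn_conformalInverse hl,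
    fun _ _ => contDiff_conformalInverse.contDiffAt⟩
  tangent_map := by
    intro y hy v hv
    have hc := cos_pos_of_mem_interiorPart hy
    have hv' : ⟪y.2, v.2⟫ = 0 := hv
    have hn := (mem_interiorPart.1 hy).2
    rw [fderiv_conformalMap hc.ne']
    simp only [tangent, lorentz, conformalMap, mem_ofPred_eq, inner_add_right,
      real_inner_smul_left, real_inner_smul_right, hv', real_inner_self_eq_norm_sq, hn,
      tan_eq_sin_div_cos]
    field_simp
    ring
  conformal := by
    intro y hy v hv w hw
    have hc := cos_pos_of_mem_interiorPart hy
    have hv' : ⟪v.2, y.2⟫ = 0 := by rw [real_inner_comm]; exact hv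
    have hw' : ⟪y.2, w.2⟫ = 0 := hw
    have hn := (mem_interiorPart.1 hy).2
    rw [fderiv_conformalMap hc.ne', fderiv_conformalMap hc.ne']
    simp only [lorentz, conformalFactor, inner_add_right, inner_add_left,
      real_inner_smul_left, real_inner_smul_right, hv', hw', real_inner_self_eq_norm_sq, hn]
    field_simp
    linear_combination (v.1 * w.1) * sin_sq_add_cos_sq y.1
  time_orientation := by
    intro y hy v _ _ hv
    have hc := cos_pos_of_mem_interiorPart hy
    rw [fderiv_conformalMap hc.ne']
    positivity
  factor_smooth := (contDiff_cos.comp contDiff_fst).div_const l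
  factor_pos _ hy := div_pos (cos_pos_of_mem_interiorPart hy) hl
  factor_zero := by
    rintro y (hy | hy) <;> simp [conformalFactor, hy.1]
  factor_deriv := by
    intro y hy
    refine ⟨(1, 0), by simp [compactifiedTangent], ?_⟩
    have h : HasFDerivAt (conformalFactor (d := d) l) _ y :=
      ((hasDerivAt_cos y.1).div_const l).comp_hasFDerivAt y
        (hasFDerivAt_fst (𝕜 := ℝ) (p := y))
    rw [h.fderiv]
    rcases hy with hy | hy <;> simp [hy.1, hl.ne']

/-! ### Timelike curves -/

/-- For a velocity `v` tangent to the unit sphere at `w`, this bounds the rate of change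
`|⟪n, v⟫| / √(1 - ⟪n, w⟫ ^ 2)` of the angle `arccos ⟪n, w⟫` by the speed `‖v‖`: the component of
`n` orthogonal to `w` has norm `√(1 - ⟪n, w⟫ ^ 2)`. -/
lemma abs_inner_le_sqrt_mul_norm {E : Type*} [NormedAddCommGroup E] [InnerProductSpace ℝ E]
    {n w v : E} (hn : ‖n‖ = 1) (hw : ‖w‖ = 1) (hwv : ⟪w, v⟫ = 0) :
    |⟪n, v⟫| ≤ √(1 - ⟪n, w⟫ ^ 2) * ‖v‖ := by
  have h1 : ⟪n, v⟫ = ⟪n - ⟪n, w⟫ • w, v⟫ := by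
    rw [inner_sub_left, real_inner_smul_left, hwv, mul_zero, sub_zero]
  have h2 : ‖n - ⟪n, w⟫ • w‖ = √(1 - ⟪n, w⟫ ^ 2) := by
    rw [← sqrt_sq (norm_nonneg (n - _)), norm_sub_sq_real, real_inner_smul_right, norm_smul, hn,
      hw, norm_eq_abs, mul_one, sq_abs]
    congr 1
    ring
  rw [h1, ← h2]
  exact abs_real_inner_le_norm _ _

/-- The time coordinate of a timelike curve that ends later than it starts is increasing: its
derivative has no zero. -/
lemma IsTimelikeCurve.derivWithin_fst_pos {γ : ℝ → Ambient d} (hγ : IsTimelikeCurve γ)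
    (h01 : (γ 0).1 < (γ 1).1) :
    ∀ t ∈ Icc (0 : ℝ) 1, 0 < (derivWithin γ (Icc 0 1) t).1 := by
  have hd : ∀ t ∈ Icc (0 : ℝ) 1, HasDerivWithinAt (fun s => (γ s).1)
      (derivWithin γ (Icc 0 1) t).1 (Icc 0 1) t := fun t ht =>
    (hγ.smooth.differentiableOn (by simp) t ht).hasDerivWithinAt.fst
  have hne : ∀ t ∈ Icc (0 : ℝ) 1, (derivWithin γ (Icc 0 1) t).1 ≠ 0 := by
    intro t ht h0
    have h := hγ.timelike t ht
    rw [lorentz, h0, real_inner_self_eq_norm_sq] at h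
    nlinarith [sq_nonneg ‖(derivWithin γ (Icc 0 1) t).2‖]
  rcases hasDerivWithinAt_forall_lt_or_forall_gt_of_forall_ne (convex_Icc 0 1) hd hne with h | h
  · have hanti : AntitoneOn (fun s => (γ s).1) (Icc 0 1) := by
      refine antitoneOn_of_hasDerivWithinAt_nonpos (convex_Icc 0 1)
        (f' := fun t => (derivWithin γ (Icc 0 1) t).1)
        (fun t ht => (hd t ht).continuousWithinAt)
        (fun t ht => (hd t (interior_subset ht)).mono interior_subset)
        (fun t ht => (h t (interior_subset ht)).le)
    exact absurd (hanti (left_mem_Icc.2 zero_le_one) (right_mem_Icc.2 zero_le_one) zero_le_one)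
      (not_le.2 h01)
  · exact h

theorem not_timelikeConnected_antipode {p : Ambient d} (hp : p ∈ scriMinus d) :
    ¬ TimelikeConnected p (antipode p) := by
  rintro ⟨γ, hγ, h0, h1⟩
  obtain ⟨hp1, hpn⟩ := hp
  have hη0 : (γ 0).1 = -(π / 2) := by rw [h0, hp1]
  have hη1 : (γ 1).1 = π / 2 := by rw [h1, antipode, hp1, neg_neg]
  have hpos := hγ.derivWithin_fst_pos (by rw [hη0, hη1]; linarith [pi_pos])
  set f : ℝ → ℝ := fun t => ⟪p.2, (γ t).2⟫ with hf
  have hγc : ContinuousOn γ (Icc 0 1) := hγ.smooth.continuousOn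
  have hfc : ContinuousOn f (Icc 0 1) := continuousOn_const.inner hγc.snd
  have hnorm : ∀ t ∈ Icc (0 : ℝ) 1, ‖(γ t).2‖ = 1 := fun t ht => (hγ.mem t ht).2.2
  have hf0 : f 0 = 1 := by simp [hf, h0, hpn]
  have hf1 : f 1 = -1 := by simp [hf, h1, antipode, hpn]
  -- `s` is the last time at which the curve points in the initial direction, and
  -- `u` is the first later time at which it points in the opposite direction.
  obtain ⟨s, ⟨hs, hfs⟩, hsmax⟩ : ∃ s, IsGreatest (Icc 0 1 ∩ f ⁻¹' {1}) s :=
    (isCompact_Icc.of_isClosed_subset (hfc.preimage_isClosed_of_isClosed isClosed_Icc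
      isClosed_singleton) inter_subset_left).exists_isGreatest ⟨0, by simp, hf0⟩
  have hsub : Icc s 1 ⊆ Icc (0 : ℝ) 1 := Icc_subset_Icc_left hs.1
  obtain ⟨u, ⟨hu, hfu⟩, humin⟩ : ∃ u, IsLeast (Icc s 1 ∩ f ⁻¹' {-1}) u :=
    (isCompact_Icc.of_isClosed_subset ((hfc.mono hsub).preimage_isClosed_of_isClosed isClosed_Icc
      isClosed_singleton) inter_subset_left).exists_isLeast ⟨1, ⟨hs.2, le_rfl⟩, hf1⟩
  simp only [mem_preimage, mem_singleton_iff] at hfs hfu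
  have hsu : s < u := lt_of_le_of_ne hu.1 fun h => by
    rw [← h, hfs] at hfu
    norm_num at hfu
  have hsub' : Icc s u ⊆ Icc (0 : ℝ) 1 := Icc_subset_Icc hs.1 hu.2
  have hmono : StrictMonoOn (fun t => (γ t).1 - arccos (f t)) (Icc s u) := by
    refine strictMonoOn_of_deriv_pos (convex_Icc s u)
      ((hγc.mono hsub').fst.sub (continuous_arccos.comp_continuousOn (hfc.mono hsub'))) ?_
    intro t ht
    rw [interior_Icc] at ht
    have ht' : t ∈ Icc (0 : ℝ) 1 := hsub' (Ioo_subset_Icc_self ht)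
    have hnhds : Icc (0 : ℝ) 1 ∈ nhds t :=
      Filter.mem_of_superset (Icc_mem_nhds ht.1 ht.2) hsub'
    have hD : HasDerivAt γ (derivWithin γ (Icc 0 1) t) t :=
      (hγ.smooth.differentiableOn (by simp) t ht').hasDerivWithinAt.hasDerivAt hnhds
    set v := derivWithin γ (Icc 0 1) t with hv
    have hD2 : HasDerivAt (fun r => (γ r).2) v.2 t := hD.snd
    have hfD : HasDerivAt f ⟪p.2, v.2⟫ t := by
      simpa using (hasDerivAt_const t p.2).inner ℝ hD2
    -- The spatial velocity is tangent to the sphere.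
    have horth : ⟪(γ t).2, v.2⟫ = 0 := by
      have hconst : (fun r => ‖(γ r).2‖ ^ 2) =ᶠ[nhds t] fun _ => (1 : ℝ) :=
        Filter.mem_of_superset hnhds fun r hr => by simp [hnorm r hr]
      have := hD2.norm_sq.unique ((hasDerivAt_const t (1 : ℝ)).congr_of_eventuallyEq hconst)
      simpa using this
    have hft1 : f t ≠ 1 := fun h => not_le.2 ht.1 (hsmax ⟨ht', h⟩)
    have hft2 : f t ≠ -1 := fun h => not_le.2 ht.2 (humin ⟨⟨ht.1.le, ht'.2⟩, h⟩)
    have habs : |f t| ≤ 1 := by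
      simpa [hf, hpn, hnorm t ht'] using abs_real_inner_le_norm p.2 (γ t).2
    have hpos2 : 0 < √(1 - f t ^ 2) := by
      apply sqrt_pos.2
      have h2 := abs_le.1 habs
      nlinarith [lt_of_le_of_ne h2.1 hft2.symm, lt_of_le_of_ne h2.2 hft1]
    have hspeed : ‖v.2‖ < v.1 := by
      have h := hγ.timelike t ht'
      rw [lorentz, real_inner_self_eq_norm_sq] at h
      exact lt_of_pow_lt_pow_left₀ 2 (hpos t ht').le (by rw [← hv] at h; linarith)
    have hη : HasDerivAt (fun r => (γ r).1) v.1 t := hD.fst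
    have hderiv : HasDerivAt (fun t => (γ t).1 - arccos (f t)) _ t :=
      hη.sub ((hasDerivAt_arccos hft2 hft1).comp t hfD)
    rw [hderiv.deriv]
    have hb : -⟪p.2, v.2⟫ ≤ √(1 - f t ^ 2) * ‖v.2‖ :=
      (neg_le_abs _).trans (abs_inner_le_sqrt_mul_norm hpn (hnorm t ht') horth)
    have hq : -⟪p.2, v.2⟫ / √(1 - f t ^ 2) ≤ ‖v.2‖ := by
      rw [div_le_iff₀ hpos2]
      linarith
    have he : -(1 / √(1 - f t ^ 2)) * ⟪p.2, v.2⟫ = -⟪p.2, v.2⟫ / √(1 - f t ^ 2) := by ring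
    rw [he]
    linarith
  have hlt := hmono (left_mem_Icc.2 hsu.le) (right_mem_Icc.2 hsu.le) hsu
  simp only [hfs, hfu, arccos_one, arccos_neg_one] at hlt
  linarith [(hγ.mem s hs).1, (hγ.mem u (hsub hu)).2.1]

/-- Every unit vector `m` other than `-n` ends a great circle arc that starts at `n`, has initial
direction `e`, and has length `α < π`. The direction is not normalized if `m = n`, where the arc is
constant. -/
lemma exists_great_circle_arc {E : Type*} [NormedAddCommGroup E] [InnerProductSpace ℝ E]
    {n m : E} (hn : ‖n‖ = 1) (hm : ‖m‖ = 1) (hmn : m ≠ -n) :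
    ∃ (α : ℝ) (e : E), 0 ≤ α ∧ α < π ∧ ⟪n, e⟫ = 0 ∧ (α = 0 ∨ ‖e‖ = 1) ∧
      cos α • n + sin α • e = m := by
  have hle : |⟪n, m⟫| ≤ 1 := by simpa [hn, hm] using abs_real_inner_le_norm n m
  obtain ⟨h1, h2⟩ := abs_le.1 hle
  have hcos : cos (arccos ⟪n, m⟫) = ⟪n, m⟫ := cos_arccos h1 h2
  have h1' : ⟪n, m⟫ ≠ -1 := fun h => hmn <| by
    rw [← neg_eq_iff_eq_neg, eq_comm, ← inner_eq_one_iff_of_norm_eq_one (𝕜 := ℝ) hn (by simpa),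
      inner_neg_right, h, neg_neg]
  by_cases h : ⟪n, m⟫ = 1
  · have hnm : n = m := (inner_eq_one_iff_of_norm_eq_one (𝕜 := ℝ) hn hm).1 h
    exact ⟨0, 0, le_rfl, pi_pos, by simp, Or.inl rfl, by simp [hnm]⟩
  set α := arccos ⟪n, m⟫ with hα
  have hπ : α < π := lt_of_le_of_ne (arccos_le_pi _) fun h => h1' <| by
    rw [← hcos, h, cos_pi]
  have h0 : 0 < α := arccos_pos.2 (lt_of_le_of_ne h2 h)
  have hs : 0 < sin α := sin_pos_of_pos_of_lt_pi h0 hπ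
  refine ⟨α, (sin α)⁻¹ • (m - cos α • n), h0.le, hπ, ?_, Or.inr ?_, ?_⟩
  · rw [real_inner_smul_right, inner_sub_right, real_inner_smul_right,
      real_inner_self_eq_norm_sq, hn, hcos]
    ring
  · rw [← sq_eq_sq₀ (norm_nonneg _) zero_le_one, norm_smul, mul_pow, norm_sub_sq_real,
      real_inner_smul_right, norm_smul, hn, hm, real_inner_comm, ← hcos, norm_eq_abs, norm_eq_abs,
      mul_one, sq_abs, sq_abs]
    field_simp
    linear_combination -sin_sq_add_cos_sq α
  · rw [smul_inv_smul₀ hs.ne']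
    abel

theorem timelikeConnected_of_ne_antipode {p q : Ambient d} (hp : p ∈ scriMinus d)
    (hq : q ∈ scriPlus d) (hpq : q ≠ antipode p) : TimelikeConnected p q := by
  obtain ⟨hp1, hpn⟩ := hp
  obtain ⟨hq1, hqn⟩ := hq
  obtain ⟨α, e, hα0, hαπ, hne, he, hend⟩ := exists_great_circle_arc hpn hqn
    fun h => hpq (Prod.ext (by simp [antipode, hp1, hq1]) h)
  let γ : ℝ → Ambient d := fun t => (-(π / 2) + t * π, cos (t * α) • p.2 + sin (t * α) • e)
  have hD : ∀ t, HasDerivAt γ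
      (π, (-sin (t * α) * α) • p.2 + (cos (t * α) * α) • e) t := by
    intro t
    have hlin : ∀ c : ℝ, HasDerivAt (fun r => r * c) c t := fun c => by
      simpa using (hasDerivAt_id t).mul_const c
    exact ((hlin π).const_add _).prodMk
      (((hlin α).cos.smul_const p.2).add ((hlin α).sin.smul_const e))
  refine ⟨γ, ⟨?_, ?_, ?_⟩, ?_, ?_⟩
  · have : ContDiff ℝ ∞ γ := by fun_prop
    exact this.contDiffOn
  · rintro t ⟨ht0, ht1⟩
    refine ⟨?_, ?_, ?_⟩
    · simp only [γ]
      nlinarith [pi_pos]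
    · simp only [γ]
      nlinarith [pi_pos]
    · rw [← sq_eq_sq₀ (norm_nonneg _) zero_le_one]
      simp only [γ]
      rw [norm_add_sq_real, real_inner_smul_left, real_inner_smul_right, hne, norm_smul,
        norm_smul, hpn, norm_eq_abs, norm_eq_abs, mul_pow, mul_pow, sq_abs, sq_abs]
      rcases he with rfl | he
      · simp
      · rw [he]
        linear_combination sin_sq_add_cos_sq (t * α)
  · intro t ht
    rw [(hD t).hasDerivWithinAt.derivWithin (uniqueDiffOn_Icc zero_lt_one t ht)]
    -- The squared velocity is `π² - α²`.
    have hspeed : ‖(-sin (t * α) * α) • p.2 + (cos (t * α) * α) • e‖ ^ 2 = α ^ 2 := by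
      rw [norm_add_sq_real, real_inner_smul_left, real_inner_smul_right, hne, norm_smul,
        norm_smul, hpn, norm_eq_abs, norm_eq_abs, mul_pow, mul_pow, sq_abs, sq_abs]
      rcases he with rfl | he
      · simp
      · rw [he]
        linear_combination α ^ 2 * sin_sq_add_cos_sq (t * α)
    rw [lorentz, real_inner_self_eq_norm_sq, hspeed]
    nlinarith
  · exact Prod.ext (by simp [γ, hp1]) (by simp [γ])
  · refine Prod.ext ?_ (by simpa [γ] using hend)
    simp only [γ, hq1]
    ring

lemma scriMinus_nonempty (d : ℕ) : (scriMinus d).Nonempty :=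
  ⟨(-(π / 2), EuclideanSpace.single 0 1), rfl, by simp⟩

lemma antipode_mem_scriPlus {p : Ambient d} (hp : p ∈ scriMinus d) : antipode p ∈ scriPlus d := by
  simpa [antipode, scriPlus, scriMinus, neg_eq_iff_eq_neg] using hp

end DeSitter

theorem proposition2p4 (d : ℕ) (hd : 1 ≤ d) (l : ℝ) (hl : 0 < l) :
    DeSitter.IsConformalCompactification d l
        (DeSitter.conformalMap l) (DeSitter.conformalFactor l) ∧
      ¬ DeSitter.PenroseProperty d ∧
      ∀ p ∈ DeSitter.scriMinus d,
        {q ∈ DeSitter.scriPlus d | ¬ DeSitter.TimelikeConnected p q} = {DeSitter.antipode p} := by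
  refine ⟨DeSitter.isConformalCompactification d hl, fun h => ?_, fun p hp => ?_⟩
  · obtain ⟨p, hp⟩ := DeSitter.scriMinus_nonempty d
    exact DeSitter.not_timelikeConnected_antipode hp
      (h p hp _ (DeSitter.antipode_mem_scriPlus hp))
  · refine Set.Subset.antisymm (fun q hq => ?_) ?_
    · by_contra hne
      exact hq.2 (DeSitter.timelikeConnected_of_ne_antipode hp hq.1 hne)
    · rintro q rfl
      exact ⟨DeSitter.antipode_mem_scriPlus hp, DeSitter.not_timelikeConnected_antipode hp⟩
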